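/- **Model.** A sequence, indexed by $n\ge 1$, of Markovian parallel server networks without abandonment, with customer classes $\mathcal I=\{1,\dots,m\}$ and server pools $\mathcal J=\{1,\dots,J\}$. Let $\mathcal E\subset\mathcal I\times\mathcal J$ be the set of pairs $(i,j)$ such that pool $j$ can serve class $i$ (written $i\sim j$); the bipartite graph $\mathcal G=(\mathcal I\cup\mathcal J,\mathcal E)$ is a tree. In the $n$-th system class $i$ arrives at rate $\lambda^n_i>0$, pool $j$ has $N^n_j$ servers, and class $i$ is served at pool $j$ at rate $\mu^n_{ij}$, with $\mu^n_{ij}>0$ if $i\sim j$ and $\mu^n_{ij}=0$ otherwise; interarrival and service times are exponential and independent. There are constants $\lambda_i,\nu_j>0$, $\mu_{ij}\ge0$ (with $\mu_{ij}>0$ exactly when $i\sim j$) and $\hat\lambda_i,\hat\mu_{ij},\hat\nu_j\in\mathbb R$ such that, as $n\to\infty$, $(\lambda^n_i-n\lambda_i)/\sqrt n\to\hat\lambda_i$, $\sqrt n(\mu^n_{ij}-\mu_{ij})\to\hat\mu_{ij}$ and $(N^n_j-n\nu_j)/\sqrt n\to\hat\nu_j$. The linear program of minimizing $\max_j\sum_i\xi_{ij}$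 over all $\xi\ge0$ that vanish off $\mathcal E$ and satisfy $\sum_j\mu_{ij}\nu_j\xi_{ij}=\lambda_i$ for all $i$ has a unique solution $\xi^*$, and it satisfies $\sum_i\xi^*_{ij}=1$ for all $j$ and $\xi^*_{ij}>0$ for $i\sim j$. **Spare capacity.** Let $\ell^n_i=\frac1{\sqrt n}\bigl(\lambda^n_i-\sum_j\mu^n_{ij}\xi^*_{ij}N^n_j\bigr)$. For $(\alpha,\beta)\in\mathbb R^m\times\mathbb R^J$ with $\sum_i\alpha_i=\sum_j\beta_j$ let $\Phi(\alpha,\beta)$ be the unique real array that vanishes off $\mathcal E$ and has row sums $\alpha_i$ and column sums $\beta_j$. For a pool $k$ let $B^n_1\in\mathbb R^{m\times m}$ and $B^n_2\in\mathbb R^{m\times J}$ be the unique matrices such that the $k$-th column of $B_2^n$ is zero and $\sum_j\mu^n_{ij}\Phi_{ij}(\alpha,\beta)=(B^n_1\alpha+B^n_2\beta)_i$ for all $i$ and all such $(\alpha,\beta)$. Set $\varrho_n=-\langle e,(B^n_1)^{-1}\ell^n\rangle$, where $e=(1,\dots,1)$. **Policies.** A stationary Markov scheduling policy of the $n$-th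 system is a map $z\colon\mathbb Z_+^m\to\mathbb Z_+^{m\times J}$ such that, for every $x$, $z_{ij}(x)=0$ if $i\nsim j$, $\sum_jz_{ij}(x)\le x_i$ for all $i$, and $\sum_iz_{ij}(x)\le N^n_j$ for all $j$; work conservation is not required. Under $z$ the vector $X^n$ of the numbers of customers of each class is the continuous-time Markov chain on $\mathbb Z_+^m$ with jumps $x\to x+e_i$ at rate $\lambda^n_i$ and $x\to x-e_i$ at rate $\sum_j\mu^n_{ij}z_{ij}(x)$. The diffusion-scaled process is $\hat X^n_i=\frac1{\sqrt n}\bigl(X^n_i-\sum_j\xi^*_{ij}N^n_j\bigr)$. **Proposition.** Let $n\ge1$. Suppose that either (a) the network has a dominant server pool $k$, that is, every pool other than $k$ is a leaf of the tree, and $B_1^n$ is taken with respect to this $k$; or (b) the service rates of the $n$-th system are class-dependent, that is, $\mu^n_{ij}=\mu^n_i$ for all $i\sim j$, and $k$ is any pool. Then, under every stationary Markov scheduling policy: - if $\varrho_n<0$, then $X^n$ and $\hat X^n$ are transient: from each state, the set of times spent at that state is almost surely bounded; - if $\varrho_n=0$, then $X^n$ and $\hat X^n$ are not positive recurrent; indeed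 no state has a finite mean return time. -/

import Mathlib

open MeasureTheory ProbabilityTheory Filter Topology
open scoped ENNReal Matrix

noncomputable section

/-! ### The network graph and the flow map `Φ` -/

/-- The undirected bipartite graph on customer classes `Fin m` and server pools `Fin J` with edge
set `E`. -/
def networkGraph {m J : ℕ} (E : Finset (Fin m × Fin J)) : SimpleGraph (Fin m ⊕ Fin J) where
  Adj
    | .inl i, .inr j => (i, j) ∈ E
    | .inr j, .inl i => (i, j) ∈ E
    | .inl _, .inl _ => False
    | .inr _, .inr _ => False
  symm := ⟨by rintro (i | j) (i' | j') h <;> exact h⟩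
  loopless := ⟨by rintro (i | j) h <;> exact h⟩

/-- `ℝ^𝓖`: real arrays that vanish off the edges. -/
def edgeSpace {m J : ℕ} (E : Finset (Fin m × Fin J)) : Submodule ℝ (Fin m → Fin J → ℝ) where
  carrier := {ψ | ∀ i j, (i, j) ∉ E → ψ i j = 0}
  add_mem' {a b} ha hb i j h := by simp [ha i j h, hb i j h]
  zero_mem' _ _ _ := rfl
  smul_mem' c a ha i j h := by simp [ha i j h]

/-- `𝒟`: pairs `(α, β)` with `∑ α_i = ∑ β_j`. -/
def balanced (m J : ℕ) : Submodule ℝ ((Fin m → ℝ) × (Fin J → ℝ)) where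
  carrier := {p | ∑ i, p.1 i = ∑ j, p.2 j}
  add_mem' {a b} ha hb := by
    simp only [Set.mem_ofPred_eq] at *
    simp [Finset.sum_add_distrib, ha, hb]
  zero_mem' := by simp
  smul_mem' c a ha := by
    simp only [Set.mem_ofPred_eq] at *
    simp [← Finset.mul_sum, ha]

/-- Row and column sums of an array supported on the edges. -/
def marginals {m J : ℕ} (E : Finset (Fin m × Fin J)) : edgeSpace E →ₗ[ℝ] balanced m J where
  toFun ψ := ⟨(fun i => ∑ j, ψ.1 i j, fun j => ∑ i, ψ.1 i j), Finset.sum_comm⟩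
  map_add' a b := by
    ext <;> simp [Finset.sum_add_distrib]
  map_smul' c a := by
    ext <;> simp [Finset.mul_sum]

theorem marginals_surjective {m J : ℕ} {E : Finset (Fin m × Fin J)}
    (h : (networkGraph E).IsTree) : Function.Surjective (marginals E) := by
  classical
  -- signed unit vectors at the vertices
  let δ : Fin m ⊕ Fin J → (Fin m → ℝ) × (Fin J → ℝ) :=
    Sum.elim (fun i => (Pi.single i 1, 0)) (fun j => (0, -Pi.single j 1))
  let R : Submodule ℝ ((Fin m → ℝ) × (Fin J → ℝ)) :=
    LinearMap.range ((balanced m J).subtype ∘ₗ marginals E)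
  have hedge : ∀ i j, (i, j) ∈ E → δ (.inl i) - δ (.inr j) ∈ R := by
    intro i j hij
    refine ⟨⟨Pi.single i (Pi.single j 1), ?_⟩, ?_⟩
    · intro i' j' h'
      by_cases hi : i' = i
      · subst hi
        by_cases hj : j' = j
        · subst hj; exact absurd hij h'
        · simp [hj]
      · simp [hi]
    · ext k
      · by_cases hk : k = i
        · subst hk; simp [marginals, δ]
        · simp [marginals, δ, hk]
      · simp only [marginals, δ, LinearMap.comp_apply, LinearMap.coe_mk, AddHom.coe_mk,
          Submodule.subtype_apply, Sum.elim_inl, Sum.elim_inr, Prod.mk_sub_mk, sub_neg_eq_add,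
          zero_add]
        rw [Finset.sum_eq_single i] <;> simp +contextual
  have hreach : ∀ u v, (networkGraph E).Reachable u v → δ u - δ v ∈ R := by
    rintro u v ⟨p⟩
    induction p with
    | nil => simp
    | @cons u v w huv _ ih =>
      have h1 : δ u - δ v ∈ R := by
        rcases u with i | j <;> rcases v with i' | j'
        · exact huv.elim
        · exact hedge i j' huv
        · rw [← neg_sub]; exact R.neg_mem (hedge i' j huv)
        · exact huv.elim
      simpa using R.add_mem h1 ih
  obtain ⟨r⟩ := h.connected.nonempty
  rintro ⟨⟨α, β⟩, hp⟩
  have hp' : ∑ i, α i = ∑ j, β j := hp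
  have key : ((α, β) : (Fin m → ℝ) × (Fin J → ℝ)) =
      ∑ i, α i • (δ (.inl i) - δ r) + ∑ j, (-β j) • (δ (.inr j) - δ r) := by
    have e1 : ∑ i, α i • δ (.inl i) = (α, 0) := by
      ext k <;> simp [δ, Prod.fst_sum, Prod.snd_sum, Finset.sum_apply, Pi.single_apply]
    have e2 : ∑ j, (-β j) • δ (.inr j) = (0, β) := by
      ext k <;> simp [δ, Prod.fst_sum, Prod.snd_sum, Finset.sum_apply, Pi.single_apply]
    simp only [smul_sub, Finset.sum_sub_distrib]
    rw [e1, e2, ← Finset.sum_smul, ← Finset.sum_smul, Finset.sum_neg_distrib, hp']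
    ext <;> simp
  have hmem : ((α, β) : (Fin m → ℝ) × (Fin J → ℝ)) ∈ R := by
    rw [key]
    exact R.add_mem
      (R.sum_mem fun i _ => R.smul_mem _ (hreach _ _ (h.connected.preconnected _ _)))
      (R.sum_mem fun j _ => R.smul_mem _ (hreach _ _ (h.connected.preconnected _ _)))
  obtain ⟨ψ, hψ⟩ := hmem
  exact ⟨ψ, Subtype.ext hψ⟩

theorem finrank_edgeSpace {m J : ℕ} (E : Finset (Fin m × Fin J)) :
    Module.finrank ℝ (edgeSpace E) = E.card := by
  let e : edgeSpace E →ₗ[ℝ] (E → ℝ) :=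
    { toFun := fun ψ p => ψ.1 p.1.1 p.1.2
      map_add' := fun _ _ => rfl
      map_smul' := fun _ _ => rfl }
  have he : Function.Bijective e := by
    constructor
    · intro a b hab
      ext i j
      by_cases hij : (i, j) ∈ E
      · exact congrFun hab ⟨(i, j), hij⟩
      · rw [a.2 i j hij, b.2 i j hij]
    · intro f
      classical
      refine ⟨⟨fun i j => if hij : (i, j) ∈ E then f ⟨(i, j), hij⟩ else 0, ?_⟩, ?_⟩
      · intro i j hij; simp [hij]
      · funext p
        simp [e]
  rw [(LinearEquiv.ofBijective e he).finrank_eq]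
  simp

theorem finrank_balanced {m J : ℕ} (h : 0 < m + J) :
    Module.finrank ℝ (balanced m J) + 1 = m + J := by
  classical
  let s : (Fin m → ℝ) × (Fin J → ℝ) →ₗ[ℝ] ℝ :=
    { toFun := fun p => ∑ i, p.1 i - ∑ j, p.2 j
      map_add' := fun a b => by simp [Finset.sum_add_distrib]; ring
      map_smul' := fun c a => by simp [← Finset.mul_sum, mul_sub] }
  have hker : LinearMap.ker s = balanced m J := by
    ext p; simp [s, balanced, sub_eq_zero]
  have hsurj : LinearMap.range s = ⊤ := by
    rw [LinearMap.range_eq_top]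
    intro c
    rcases Nat.eq_zero_or_pos m with hm | hm
    · have hJ : 0 < J := by omega
      exact ⟨(0, Pi.single ⟨0, hJ⟩ (-c)), by simp [s]⟩
    · exact ⟨(Pi.single ⟨0, hm⟩ c, 0), by simp [s]⟩
  have := s.finrank_range_add_finrank_ker
  rw [hker, hsurj, finrank_top] at this
  simp at this
  omega

theorem card_edges {m J : ℕ} {E : Finset (Fin m × Fin J)} (h : (networkGraph E).IsTree) :
    E.card + 1 = m + J := by
  classical
  have h1 := h.card_edgeFinset
  have h2 : (networkGraph E).edgeFinset = E.image (fun p => s(Sum.inl p.1, Sum.inr p.2)) := by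
    ext q
    induction q with
    | _ u v =>
      simp only [SimpleGraph.mem_edgeFinset, SimpleGraph.mem_edgeSet, Finset.mem_image,
        Prod.exists, Sym2.eq_iff]
      rcases u with i | j <;> rcases v with i' | j' <;> simp [networkGraph]
  rw [h2, Finset.card_image_of_injective] at h1
  · simpa using h1
  · rintro ⟨i, j⟩ ⟨i', j'⟩ hh
    simpa [Sym2.eq_iff] using hh

theorem marginals_bijective {m J : ℕ} {E : Finset (Fin m × Fin J)}
    (h : (networkGraph E).IsTree) : Function.Bijective (marginals E) := by
  have hs := marginals_surjective h
  have hc := card_edges h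
  have hb := finrank_balanced (m := m) (J := J) (by omega)
  have hd : Module.finrank ℝ (edgeSpace E) = Module.finrank ℝ (balanced m J) := by
    rw [finrank_edgeSpace]; omega
  exact ⟨(LinearMap.injective_iff_surjective_of_finrank_eq_finrank hd).2 hs, hs⟩

/-- The linear map `Φ : 𝒟 → ℝ^𝓖` of a tree: `Φ(α, β)` is the unique array in `ℝ^𝓖` with row sums
`α` and column sums `β`. -/
def flowMap {m J : ℕ} {E : Finset (Fin m × Fin J)} (h : (networkGraph E).IsTree) :
    balanced m J ≃ₗ[ℝ] edgeSpace E :=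
  (LinearEquiv.ofBijective (marginals E) (marginals_bijective h)).symm

theorem flowMap_marginals {m J : ℕ} {E : Finset (Fin m × Fin J)} (h : (networkGraph E).IsTree)
    (p : balanced m J) :
    (∀ i, ∑ j, (flowMap h p).1 i j = p.1.1 i) ∧ (∀ j, ∑ i, (flowMap h p).1 i j = p.1.2 j) := by
  have := (LinearEquiv.ofBijective (marginals E) (marginals_bijective h)).apply_symm_apply p
  exact ⟨fun i => congrFun (congrArg (fun q => q.1.1) this) i,
    fun j => congrFun (congrArg (fun q => q.1.2) this) j⟩

/-- The element `(e_i, e_j)` of `𝒟`. -/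
def unitPair {m J : ℕ} (i : Fin m) (j : Fin J) : balanced m J :=
  ⟨(Pi.single i 1, Pi.single j 1), by simp [balanced]⟩

/-- The element `(0, e_j - e_j')` of `𝒟`. -/
def poolDiff {m J : ℕ} (j j' : Fin J) : balanced m J :=
  ⟨(0, Pi.single j 1 - Pi.single j' 1), by simp [balanced]⟩

/-- The matrix `B₁` of the network with service rates `μ`, for the basis `(α, (β)_{-k})`: the
`α`-part of the linear map `(α, β) ↦ (∑_j μ_ij Φ_ij(α, β))_i` on `𝒟`, when `𝒟` is parametrized by
`α` and the `β_j`, `j ≠ k`. Its `a`-th column is the value at `α = e_a`, `(β)_{-k} = 0`, and then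
`β_k = 1` by the balance of `𝒟`. -/
def driftMatrix {m J : ℕ} {E : Finset (Fin m × Fin J)} (h : (networkGraph E).IsTree)
    (μ : Fin m → Fin J → ℝ) (k : Fin J) : Matrix (Fin m) (Fin m) ℝ :=
  Matrix.of fun i a => ∑ j, μ i j * (flowMap h (unitPair a k)).1 i j

/-- The matrix `B₂` for the basis `(α, (β)_{-k})`; its `k`-th column is zero. -/
def driftMatrix₂ {m J : ℕ} {E : Finset (Fin m × Fin J)} (h : (networkGraph E).IsTree)
    (μ : Fin m → Fin J → ℝ) (k : Fin J) : Matrix (Fin m) (Fin J) ℝ :=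
  Matrix.of fun i b => ∑ j, μ i j * (flowMap h (poolDiff b k)).1 i j

/-- `∑_j μ_ij Φ_ij(α, β) = (B₁ α + B₂ β)_i` on `𝒟`: the defining relation of `B₁` and `B₂`. -/
theorem driftMatrix_spec {m J : ℕ} {E : Finset (Fin m × Fin J)} (h : (networkGraph E).IsTree)
    (μ : Fin m → Fin J → ℝ) (k : Fin J) (p : balanced m J) (i : Fin m) :
    ∑ j, μ i j * (flowMap h p).1 i j =
      (driftMatrix h μ k *ᵥ p.1.1 + driftMatrix₂ h μ k *ᵥ p.1.2) i := by
  classical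
  let L : balanced m J →ₗ[ℝ] ℝ :=
    { toFun := fun q => ∑ j, μ i j * (flowMap h q).1 i j
      map_add' := fun a b => by simp [mul_add, Finset.sum_add_distrib]
      map_smul' := fun c a => by
        simp only [map_smul, Submodule.coe_smul, Pi.smul_apply, smul_eq_mul, Finset.mul_sum,
          RingHom.id_apply]
        exact Finset.sum_congr rfl fun j _ => by ring }
  have hp : ∑ a, p.1.1 a = ∑ b, p.1.2 b := p.2
  have hdec : p = ∑ a, p.1.1 a • unitPair a k + ∑ b, p.1.2 b • poolDiff b k := by
    apply Subtype.ext
    ext c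
    · simp [unitPair, poolDiff, Prod.fst_sum, Finset.sum_apply, Pi.single_apply]
    · simp [unitPair, poolDiff, Prod.snd_sum, Finset.sum_apply, Pi.single_apply, mul_sub,
        Finset.sum_sub_distrib]
      split_ifs <;> simp [hp]
  change L p = _
  conv_lhs => rw [hdec]
  simp only [map_add, map_sum, map_smul, smul_eq_mul, Pi.add_apply, Matrix.mulVec, dotProduct]
  congr 1 <;> exact Finset.sum_congr rfl fun a _ => mul_comm _ _

/-! ### The sequence of networks -/

/-- Feasible points `ξ ∈ ℝ₊^𝓖` of the fluid linear program. -/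
def LPFeasible {m J : ℕ} (E : Finset (Fin m × Fin J)) (lam : Fin m → ℝ) (mu : Fin m → Fin J → ℝ)
    (nu : Fin J → ℝ) (ξ : Fin m → Fin J → ℝ) : Prop :=
  (∀ i j, 0 ≤ ξ i j) ∧ (∀ i j, (i, j) ∉ E → ξ i j = 0) ∧
    ∀ i, ∑ j, mu i j * nu j * ξ i j = lam i

/-- `ξ` solves the linear program: minimize `max_j ∑_i ξ_ij` over the feasible points. -/
def LPOptimal {m J : ℕ} (E : Finset (Fin m × Fin J)) (lam : Fin m → ℝ) (mu : Fin m → Fin J → ℝ)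
    (nu : Fin J → ℝ) (ξ : Fin m → Fin J → ℝ) : Prop :=
  LPFeasible E lam mu nu ξ ∧
    ∀ ξ', LPFeasible E lam mu nu ξ' → (⨆ j, ∑ i, ξ i j) ≤ ⨆ j, ∑ i, ξ' i j

/-- A sequence (indexed by `n ≥ 1`) of Markovian parallel server networks with `m` customer classes,
`J` server pools and tree topology, in the Halfin–Whitt regime and under complete resource
pooling. -/
structure ServerNetworks (m J : ℕ) where
  /-- the pairs `(i, j)` such that pool `j` can serve class `i` -/
  edges : Finset (Fin m × Fin J)
  isTree : (networkGraph edges).IsTree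
  /-- arrival rates `λ_i^n` -/
  arrival : ℕ → Fin m → ℝ
  /-- service rates `μ_ij^n` -/
  service : ℕ → Fin m → Fin J → ℝ
  /-- numbers of servers `N_j^n` -/
  servers : ℕ → Fin J → ℕ
  arrival_pos : ∀ n, 1 ≤ n → ∀ i, 0 < arrival n i
  service_pos : ∀ n, 1 ≤ n → ∀ i j, (i, j) ∈ edges → 0 < service n i j
  service_zero : ∀ n, 1 ≤ n → ∀ i j, (i, j) ∉ edges → service n i j = 0
  /-- limits `λ_i`, `μ_ij`, `ν_j` -/
  lam : Fin m → ℝ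
  mu : Fin m → Fin J → ℝ
  nu : Fin J → ℝ
  lam_pos : ∀ i, 0 < lam i
  mu_pos : ∀ i j, (i, j) ∈ edges → 0 < mu i j
  mu_zero : ∀ i j, (i, j) ∉ edges → mu i j = 0
  nu_pos : ∀ j, 0 < nu j
  /-- second-order limits -/
  lamHat : Fin m → ℝ
  muHat : Fin m → Fin J → ℝ
  nuHat : Fin J → ℝ
  tendsto_arrival : ∀ i,
    Tendsto (fun n : ℕ => (arrival n i - n * lam i) / √(n : ℝ)) atTop (𝓝 (lamHat i))
  tendsto_service : ∀ i j,
    Tendsto (fun n : ℕ => √(n : ℝ) * (service n i j - mu i j)) atTop (𝓝 (muHat i j))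
  tendsto_servers : ∀ j,
    Tendsto (fun n : ℕ => ((servers n j : ℝ) - n * nu j) / √(n : ℝ)) atTop (𝓝 (nuHat j))
  /-- the unique solution `ξ*` of the fluid linear program -/
  xi : Fin m → Fin J → ℝ
  xi_unique : ∀ ξ, LPOptimal edges lam mu nu ξ ↔ ξ = xi
  xi_sum : ∀ j, ∑ i, xi i j = 1
  xi_pos : ∀ i j, (i, j) ∈ edges → 0 < xi i j

namespace ServerNetworks

variable {m J : ℕ} (S : ServerNetworks m J)

/-- The vector `ℓ^n`. -/
def ell (n : ℕ) (i : Fin m) : ℝ :=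
  (S.arrival n i - ∑ j, S.service n i j * S.xi i j * S.servers n j) / √(n : ℝ)

/-- The spare capacity `ϱ_n = -⟨e, (B₁^n)⁻¹ ℓ^n⟩`, with `B₁^n` taken in the basis `(α, (β)_{-k})`. -/
def spareCapacity (n : ℕ) (k : Fin J) : ℝ :=
  -∑ i, ((driftMatrix S.isTree (S.service n) k)⁻¹ *ᵥ S.ell n) i

/-- `k` is a dominant server pool: every other pool is a leaf of the tree. -/
def IsDominantPool (k : Fin J) : Prop :=
  ∀ j, j ≠ k → ∃! i, (i, j) ∈ S.edges

/-- The service rates in the `n`-th system depend on the customer class only. -/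
def HasClassDependentRates (n : ℕ) : Prop :=
  ∃ μ : Fin m → ℝ, ∀ i j, (i, j) ∈ S.edges → S.service n i j = μ i

/-- A stationary Markov scheduling policy of the `n`-th system: when the class counts are `x`,
`z x i j` customers of class `i` are in service at pool `j`; only edges are used, and the
queue lengths `x_i - ∑_j z_ij` and the numbers of idle servers `N_j^n - ∑_i z_ij` are nonnegative.
Work conservation is not required. -/
def IsPolicy (n : ℕ) (z : (Fin m → ℕ) → Fin m → Fin J → ℕ) : Prop :=
  ∀ x, (∀ i j, (i, j) ∉ S.edges → z x i j = 0) ∧ (∀ i, ∑ j, z x i j ≤ x i) ∧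
    ∀ j, ∑ i, z x i j ≤ S.servers n j

/-- The jump rates of the class counts `X^n` under the policy `z`: from `x` to `x + e_i` at rate
`λ_i^n`, and to `x - e_i` at rate `∑_j μ_ij^n z_ij(x)` (which is zero when `x_i = 0`), so that
`∫ (f y - f x) d(rates n z x)(y)` is the controlled generator applied to `f`, at `x`. -/
def rates (n : ℕ) (z : (Fin m → ℕ) → Fin m → Fin J → ℕ) (x : Fin m → ℕ) :
    Measure (Fin m → ℕ) :=
  ∑ i, (ENNReal.ofReal (S.arrival n i) • Measure.dirac (x + Pi.single i 1) +
    ENNReal.ofReal (∑ j, S.service n i j * z x i j) • Measure.dirac (x - Pi.single i 1))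

/-- The diffusion scaling `x ↦ (x - n x̄^n) / √n`, where `n x̄_i^n = ∑_j ξ*_ij N_j^n`. -/
def diffusionScale (n : ℕ) (x : Fin m → ℕ) : Fin m → ℝ :=
  fun i => ((x i : ℝ) - ∑ j, S.xi i j * S.servers n j) / √(n : ℝ)

end ServerNetworks

/-! ### Continuous-time Markov chains -/

namespace CTMC

/-- The time of the `k`-th jump, where `(ω (l + 1)).2` is the time between the `l`-th and the
`(l + 1)`-st jump. -/
def jumpTime {X : Type*} (ω : ℕ → X × ℝ) (k : ℕ) : ℝ :=
  ∑ l ∈ Finset.range k, (ω (l + 1)).2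

/-- With `(ω k).1` the state after `k` jumps: the state at time `t ≥ 0`; `none` stands for the cemetery state after an explosion. -/
def process {X : Type*} (ω : ℕ → X × ℝ) (t : ℝ) : Option X :=
  open Classical in
  if h : ∃ k, jumpTime ω k ≤ t ∧ t < jumpTime ω (k + 1) then some (ω (Nat.find h)).1 else none

/-- The first time at or after the first jump at which `φ(X_t) = φ(x)`; `⊤` if there is none. -/
def returnTime {X E : Type*} (φ : X → E) (x : X) (ω : ℕ → X × ℝ) : ℝ≥0∞ :=
  ⨅ t ∈ {t : ℝ | jumpTime ω 1 ≤ t ∧ (process ω t).map φ = some (φ x)}, ENNReal.ofReal t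

variable {X E : Type*} [MeasurableSpace X]

/-- The joint law of the holding time at `x` and of the state entered next, for a chain which jumps
from `x` into `A` at rate `rate x A`: an exponential time with the total rate as parameter, and
independently a state with law `rate x` normalized. At a state without jumps the law is the point
mass at `(x, 1)`: the path is then constant, recorded in time units of length one. -/
def stepLaw (rate : X → Measure X) (x : X) : Measure (X × ℝ) :=
  open Classical in
  if 0 < (rate x).real Set.univ then
    ((rate x Set.univ)⁻¹ • rate x).prod (expMeasure ((rate x).real Set.univ))
  else Measure.dirac (x, 1)

instance (rate : X → Measure X) (x : X) : IsProbabilityMeasure (stepLaw rate x) := by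
  unfold stepLaw
  split_ifs with h
  · have h1 := isProbabilityMeasure_expMeasure h
    have h0 : 0 < rate x Set.univ ∧ rate x Set.univ < ⊤ := ENNReal.toReal_pos_iff.1 h
    have h2 : IsProbabilityMeasure ((rate x Set.univ)⁻¹ • rate x) :=
      ⟨by simp [ENNReal.inv_mul_cancel h0.1.ne' h0.2.ne]⟩
    infer_instance
  · infer_instance

variable [Countable X] [MeasurableSingletonClass X]

/-- The transition kernel of (state, length of the holding time just completed). -/
def stepKernel (rate : X → Measure X) : Kernel (X × ℝ) (X × ℝ) :=
  (Kernel.ofFunOfCountable (stepLaw rate)).comap Prod.fst measurable_fst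

instance (rate : X → Measure X) : IsMarkovKernel (stepKernel rate) :=
  ⟨fun p => by
    change IsProbabilityMeasure (stepLaw rate p.1)
    infer_instance⟩

/-- The law, for the chain started at `x`, of the sequence `ω` in which `(ω k).1` is the state after
`k` jumps and `(ω (k + 1)).2` is the time between the `k`-th and the `(k + 1)`-st jump. -/
def law (rate : X → Measure X) (x : X) : Measure (ℕ → X × ℝ) :=
  Kernel.trajMeasure (X := fun _ => X × ℝ) (Measure.dirac (x, 0))
    fun n => (stepKernel rate).comap (fun h => h ⟨n, by simp⟩) (measurable_pi_apply _)

/-- The process `φ(X_t)`, with `φ` injective, is transient: from every state `x`, almost surely the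
set of times spent at `x` is bounded. -/
def IsTransient (rate : X → Measure X) (φ : X → E) : Prop :=
  ∀ x, ∀ᵐ ω ∂law rate x, BddAbove {t : ℝ | 0 ≤ t ∧ (process ω t).map φ = some (φ x)}

/-- The state `φ(x)` of the process `φ(X_t)`, with `φ` injective, is positive recurrent: its mean
return time is finite. -/
def IsPositiveRecurrentAt (rate : X → Measure X) (φ : X → E) (x : X) : Prop :=
  ∫⁻ ω, returnTime φ x ω ∂law rate x < ⊤

end CTMC

end

noncomputable section

/-! ### The embedded jump chain: holding times and the Markov property -/

namespace CTMC

variable {X : Type*} [MeasurableSpace X]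

/-! In both cases there are weights `w i > 0` and constants `c j` with `w i * μ_ij = c j` on every
edge, and `B₁` is the diagonal matrix of the `1 / w i` (`exists_weights`). Hence `-ϱ_n = ∑ w i *
ℓ_i`. Let `V x = ∑ w i * x i`. A busy server of pool `j` drains `V` at rate `c j` whichever class it
serves, so no policy drains faster than `∑ c j * N_j`. Since the columns of `ξ*` sum to one, the
drift of `V` is therefore at least `-√n ϱ_n` in every state (`drift_ge`).

If `ϱ_n < 0`, this drift is bounded below by a positive constant while jump sizes and jump rates are
bounded. For small `θ > 0` the jump chain then contracts `exp (-θ V)` in mean by a factor `r < 1`,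
so it is at its starting state after `k` jumps with probability at most `r ^ k`. By Borel–Cantelli
there are finitely many visits (`isTransient_of_contraction`).

If `ϱ_n = 0`, then `u = (V - V x)⁺` is subharmonic for the jump chain and vanishes at `x`. The mean
of `u` after `l` jumps, on the event of no return so far, is nondecreasing in `l`, positive at `l =
1`, and at most `l * W` times the probability of that event, where `W` bounds the increments of `u`.
The non-return probabilities are thus at least of order `1 / l` and have infinite sum. As holding
times have means bounded below, the mean return time is infinite
(`not_isPositiveRecurrentAt_of_subharmonic`).

The scaling is injective, so `X^n` and its scaled version are both covered by stating the criteria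
for an injective `φ`. -/

theorem ae_nonneg_stepLaw (rate : X → Measure X) (y : X) : ∀ᵐ p ∂stepLaw rate y, 0 ≤ p.2 := by
  unfold stepLaw
  split_ifs with h
  · have : IsProbabilityMeasure (expMeasure ((rate y).real Set.univ)) :=
      isProbabilityMeasure_expMeasure h
    have hexp : ∀ᵐ t ∂expMeasure ((rate y).real Set.univ), 0 ≤ t := by
      rw [ae_iff]
      have : {t : ℝ | ¬ 0 ≤ t} = Set.Iio 0 := by ext; simp
      rw [this, expMeasure, gammaMeasure, withDensity_apply _ measurableSet_Iio]
      exact lintegral_exponentialPDF_of_nonpos le_rfl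
    exact Measure.quasiMeasurePreserving_snd.ae hexp
  · rw [ae_dirac_iff (measurableSet_le measurable_const measurable_snd)]
    exact zero_le_one

/-- A crude bound suffices: the exponential law puts mass `exp (-1)` beyond `1 / r`. -/
theorem lintegral_expMeasure_ge {r : ℝ} (hr : 0 < r) :
    ENNReal.ofReal (Real.exp (-1) / r) ≤ ∫⁻ t, ENNReal.ofReal t ∂expMeasure r := by
  have hP : IsProbabilityMeasure (expMeasure r) := isProbabilityMeasure_expMeasure hr
  have hcdf : (expMeasure r).real (Set.Iic (1 / r)) = 1 - Real.exp (-1) := by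
    rw [← cdf_eq_real, cdf_expMeasure_eq hr, if_pos (by positivity)]
    congr 3
    field_simp
  have hIoi : expMeasure r (Set.Ioi (1 / r)) = ENNReal.ofReal (Real.exp (-1)) := by
    have : (expMeasure r).real (Set.Ioi (1 / r)) = Real.exp (-1) := by
      rw [← Set.compl_Iic, probReal_compl_eq_one_sub measurableSet_Iic, hcdf]
      ring
    rw [← this, ofReal_measureReal]
  calc ENNReal.ofReal (Real.exp (-1) / r)
      = ∫⁻ t in Set.Ioi (1 / r), ENNReal.ofReal (1 / r) ∂expMeasure r := by
        rw [setLIntegral_const, hIoi, ← ENNReal.ofReal_mul (by positivity)]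
        congr 1
        ring
    _ ≤ ∫⁻ t in Set.Ioi (1 / r), ENNReal.ofReal t ∂expMeasure r :=
        setLIntegral_mono (by fun_prop) fun t ht => ENNReal.ofReal_le_ofReal (le_of_lt ht)
    _ ≤ _ := setLIntegral_le_lintegral _ _

theorem lintegral_snd_stepLaw_ge (rate : X → Measure X) {y : X} {R : ℝ}
    (h0 : 0 < (rate y).real Set.univ) (hR : (rate y).real Set.univ ≤ R) :
    ENNReal.ofReal (Real.exp (-1) / R) ≤ ∫⁻ p, ENNReal.ofReal p.2 ∂stepLaw rate y := by
  have h1 : 0 < rate y Set.univ ∧ rate y Set.univ < ⊤ := ENNReal.toReal_pos_iff.1 h0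
  have := isProbabilityMeasure_expMeasure h0
  have hmap : (stepLaw rate y).map Prod.snd = expMeasure ((rate y).real Set.univ) := by
    rw [stepLaw, if_pos h0, Measure.map_snd_prod]
    simp [ENNReal.inv_mul_cancel h1.1.ne' h1.2.ne]
  rw [← lintegral_map (f := ENNReal.ofReal) (by fun_prop) measurable_snd, hmap]
  refine le_trans (ENNReal.ofReal_le_ofReal ?_) (lintegral_expMeasure_ge h0)
  gcongr

variable [Countable X] [MeasurableSingletonClass X]

instance isProbabilityMeasure_law (rate : X → Measure X) (x : X) :
    IsProbabilityMeasure (law rate x) := by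
  unfold law
  infer_instance

theorem ae_law_zero (rate : X → Measure X) (x : X) : ∀ᵐ ω ∂law rate x, ω 0 = (x, 0) := by
  have hmap : (law rate x).map (fun ω => ω 0) = Measure.dirac (x, 0) := by
    have h0 : (fun ω : ℕ → X × ℝ => ω 0) =
        (MeasurableEquiv.piUnique fun _ : Finset.Iic 0 => X × ℝ) ∘ Preorder.frestrictLe 0 := rfl
    rw [h0, ← Measure.map_map (by fun_prop) (by fun_prop), law, Kernel.trajMeasure,
      Measure.map_comp _ _ (by fun_prop), Kernel.traj_map_frestrictLe, Kernel.partialTraj_self,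
      Measure.id_comp, Measure.map_map (by fun_prop) (by fun_prop)]
    simp
  have : ∀ᵐ p ∂(law rate x).map (fun ω => ω 0), p = (x, 0) := by
    rw [hmap, ae_dirac_iff (measurableSet_eq)]
  exact ae_of_ae_map (measurable_pi_apply 0).aemeasurable this

/-- The Markov property of the embedded jump chain with holding times. -/
theorem lintegral_law_succ (rate : X → Measure X) (x : X) (n : ℕ)
    {G : (Finset.Iic n → X × ℝ) × (X × ℝ) → ℝ≥0∞} (hG : Measurable G) :
    ∫⁻ ω, G (Preorder.frestrictLe n ω, ω (n + 1)) ∂law rate x =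
      ∫⁻ ω, ∫⁻ p, G (Preorder.frestrictLe n ω, p) ∂stepLaw rate (ω n).1 ∂law rate x := by
  have h := Kernel.map_frestrictLe_trajMeasure_compProd_eq_map_trajMeasure
    (X := fun _ => X × ℝ) (μ₀ := Measure.dirac (x, 0))
    (κ := fun n => (stepKernel rate).comap (fun h => h ⟨n, by simp⟩) (measurable_pi_apply _))
    (a := n)
  have h1 : ∫⁻ q, G q ∂_ = ∫⁻ q, G q ∂_ := congrArg (fun μ => ∫⁻ q, G q ∂μ) h
  rw [Measure.lintegral_compProd hG, lintegral_map hG (by fun_prop),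
    lintegral_map hG.lintegral_kernel_prod_right' (by fun_prop)] at h1
  exact h1.symm

theorem lintegral_law_succ_mul (rate : X → Measure X) (x : X) (n : ℕ)
    {φ : (Finset.Iic n → X × ℝ) → ℝ≥0∞} (hφ : Measurable φ)
    {F : X × ℝ → ℝ≥0∞} (hF : Measurable F) :
    ∫⁻ ω, φ (Preorder.frestrictLe n ω) * F (ω (n + 1)) ∂law rate x =
      ∫⁻ ω, φ (Preorder.frestrictLe n ω) * ∫⁻ p, F p ∂stepLaw rate (ω n).1 ∂law rate x := by
  rw [lintegral_law_succ rate x n (G := fun q => φ q.1 * F q.2) (by fun_prop)]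
  simp_rw [lintegral_const_mul _ hF]

/-- By the Markov property the probability of a violation at step `n` is the mean of its one-step
probabilities, all of which are zero. -/
theorem ae_law_succ (rate : X → Measure X) (x : X) {R : X → X × ℝ → Prop}
    (hR : ∀ y, MeasurableSet {p | R y p}) (h : ∀ y, ∀ᵐ p ∂stepLaw rate y, R y p) :
    ∀ᵐ ω ∂law rate x, ∀ n, R (ω n).1 (ω (n + 1)) := by
  rw [ae_all_iff]
  intro n
  let s : Set (X × (X × ℝ)) := {q | ¬ R q.1 q.2}
  have hs : MeasurableSet s := by
    -- Countability of `X` gives joint measurability from measurability of the sections.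
    have : s = ⋃ y, ({y} : Set X) ×ˢ {p | R y p}ᶜ := by
      ext ⟨y, p⟩
      simp [s]
    rw [this]
    exact .iUnion fun y => (measurableSet_singleton y).prod (hR y).compl
  have hm : Measurable (s.indicator fun _ => (1 : ℝ≥0∞)) := measurable_const.indicator hs
  have hG : Measurable fun q : (Finset.Iic n → X × ℝ) × (X × ℝ) =>
      s.indicator (fun _ => (1 : ℝ≥0∞)) ((q.1 ⟨n, by simp⟩).1, q.2) :=
    hm.comp (by fun_prop)
  have key := lintegral_law_succ rate x n hG
  have h0 : ∀ y, ∫⁻ p, s.indicator (fun _ => (1 : ℝ≥0∞)) (y, p) ∂stepLaw rate y = 0 := by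
    intro y
    have hy : Measurable fun p : X × ℝ => s.indicator (fun _ => (1 : ℝ≥0∞)) (y, p) :=
      hm.comp (by fun_prop)
    rw [lintegral_eq_zero_iff hy]
    filter_upwards [h y] with p hp
    simp [s, hp]
  simp only [Preorder.frestrictLe_apply, h0, lintegral_zero] at key
  have hω : Measurable fun ω : ℕ → X × ℝ =>
      s.indicator (fun _ => (1 : ℝ≥0∞)) ((ω n).1, ω (n + 1)) := hm.comp (by fun_prop)
  rw [lintegral_eq_zero_iff hω] at key
  filter_upwards [key] with ω hω
  by_contra hc
  simp [s, hc] at hω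

theorem lintegral_fst_stepLaw (rate : X → Measure X) {y : X} (h0 : 0 < (rate y).real Set.univ)
    (u : X → ℝ≥0∞) :
    ∫⁻ p, u p.1 ∂stepLaw rate y = (rate y Set.univ)⁻¹ * ∫⁻ y', u y' ∂rate y := by
  have := isProbabilityMeasure_expMeasure h0
  rw [← lintegral_map (f := u) (measurable_of_countable u) measurable_fst, stepLaw, if_pos h0,
    Measure.map_fst_prod]
  simp [lintegral_smul_measure]

end CTMC

namespace CTMC

/-- Translates times spent at `x` into visits of the jump chain; this is how paths in continuous
time enter both criteria. -/
theorem jumpTime_le_of_process {X E : Type*} {φ : X → E} (hφ : φ.Injective) {x : X}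
    {ω : ℕ → X × ℝ} {t : ℝ} (h : (process ω t).map φ = some (φ x)) :
    ∃ k, (ω k).1 = x ∧ jumpTime ω k ≤ t ∧ t < jumpTime ω (k + 1) := by
  classical
  unfold process at h
  split_ifs at h with hk
  · refine ⟨_, ?_, Nat.find_spec hk⟩
    simpa [hφ.eq_iff] using h
  · simp at h

variable {X E : Type*} [MeasurableSpace X] [Countable X] [MeasurableSingletonClass X]

/-! ### Transience -/

/-- A positive function which the embedded jump chain contracts in mean forces transience. -/
theorem isTransient_of_contraction (rate : X → Measure X) {φ : X → E} (hφ : φ.Injective)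
    (h : X → ℝ≥0∞) (h0 : ∀ y, h y ≠ 0) (htop : ∀ y, h y ≠ ⊤) {r : ℝ≥0∞} (hr : r < 1)
    (hcontr : ∀ y, ∫⁻ p, h p.1 ∂stepLaw rate y ≤ r * h y) :
    IsTransient rate φ := by
  intro x
  have hm : Measurable h := measurable_of_countable h
  have hdecay : ∀ k, ∫⁻ ω, h (ω k).1 ∂law rate x ≤ r ^ k * h x := by
    intro k
    induction k with
    | zero =>
      rw [lintegral_congr_ae (g := fun _ => h x)]
      · simp
      · filter_upwards [ae_law_zero rate x] with ω hω
        rw [hω]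
    | succ k ih =>
      have := lintegral_law_succ_mul rate x k (φ := fun _ => 1) measurable_const
        (F := fun p => h p.1) (by fun_prop)
      simp only [one_mul] at this
      rw [this]
      calc ∫⁻ ω, ∫⁻ p, h p.1 ∂stepLaw rate (ω k).1 ∂law rate x
          ≤ ∫⁻ ω, r * h (ω k).1 ∂law rate x := lintegral_mono fun ω => hcontr _
        _ = r * ∫⁻ ω, h (ω k).1 ∂law rate x := lintegral_const_mul _ (by fun_prop)
        _ ≤ r * (r ^ k * h x) := by gcongr
        _ = r ^ (k + 1) * h x := by ring
  -- Markov's inequality at level `h x`.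
  have hvisit : ∀ k, law rate x {ω | (ω k).1 = x} ≤ r ^ k := by
    intro k
    have h1 : h x * law rate x {ω | (ω k).1 = x} ≤ ∫⁻ ω, h (ω k).1 ∂law rate x := by
      refine le_trans ?_ (mul_meas_ge_le_lintegral (by fun_prop) (h x))
      gcongr
      rintro rfl
      exact le_rfl
    have h2 := h1.trans (hdecay k)
    rw [mul_comm (r ^ k)] at h2
    exact (ENNReal.mul_le_mul_iff_right (h0 x) (htop x)).1 h2
  have hsum : ∑' k, law rate x {ω | (ω k).1 = x} ≠ ⊤ := by
    refine ne_top_of_le_ne_top ?_ (ENNReal.tsum_le_tsum hvisit)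
    rw [ENNReal.tsum_geometric]
    rw [ne_eq, ENNReal.inv_eq_top, tsub_eq_zero_iff_le]
    exact not_le.2 hr
  -- Borel–Cantelli: from some index `K` on, the chain is never at `x`. Every time spent at `x` then
  -- precedes the end of one of the first `K` holding intervals.
  filter_upwards [ae_eventually_notMem hsum] with ω hω
  obtain ⟨K, hK⟩ := eventually_atTop.1 hω
  obtain ⟨b, hb⟩ := ((Finset.range K).image fun k => jumpTime ω (k + 1)).bddAbove
  refine ⟨b, fun t ht => ?_⟩
  obtain ⟨k, hkx, -, hk⟩ := jumpTime_le_of_process hφ ht.2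
  have hkK : k < K := by
    by_contra hc
    exact hK k (not_lt.1 hc) hkx
  exact hk.le.trans (hb (by simpa using ⟨k, hkK, rfl⟩))

/-! ### Mean return times -/

/-- Histories of `k` jumps without a return to `x`. -/
def avoiding (x : X) (k : ℕ) : Set (Finset.Iic k → X × ℝ) :=
  {h | ∀ j, 1 ≤ j.1 → (h j).1 ≠ x}

omit [Countable X] in
theorem measurableSet_avoiding (x : X) (k : ℕ) : MeasurableSet (avoiding x k) := by
  have : avoiding x k = ⋂ j : Finset.Iic k, {h | 1 ≤ j.1 → (h j).1 ≠ x} := by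
    ext; simp [avoiding]
  rw [this]
  refine .iInter fun j => ?_
  by_cases hj : 1 ≤ j.1
  · simp only [hj, true_imp_iff]
    have : Measurable fun h : Finset.Iic k → X × ℝ => (h j).1 := by fun_prop
    exact this (measurableSet_singleton x).compl
  · simp [hj]

omit [MeasurableSpace X] [Countable X] [MeasurableSingletonClass X] in
theorem frestrictLe_mem_avoiding {x : X} {k : ℕ} {ω : ℕ → X × ℝ} :
    Preorder.frestrictLe k ω ∈ avoiding x k ↔ ∀ j, 1 ≤ j → j ≤ k → (ω j).1 ≠ x := by
  simp only [avoiding, Set.mem_ofPred_eq, Subtype.forall, Finset.mem_Iic,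
    Preorder.frestrictLe_apply]
  exact ⟨fun h j h1 h2 => h j h2 h1, fun h j h1 h2 => h j h2 h1⟩

theorem lintegral_const_mul_avoiding (rate : X → Measure X) (x : X) (l : ℕ) (d : ℝ≥0∞) :
    ∫⁻ ω, d * (avoiding x l).indicator (fun _ => 1) (Preorder.frestrictLe l ω) ∂law rate x =
      d * law rate x (Preorder.frestrictLe l ⁻¹' avoiding x l) := by
  have hs : MeasurableSet (Preorder.frestrictLe (π := fun _ => X × ℝ) l ⁻¹' avoiding x l) :=
    (measurableSet_avoiding x l).preimage (by fun_prop)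
  rw [← lintegral_indicator_one hs,
    ← lintegral_const_mul d (f := Set.indicator _ 1) (measurable_one.indicator hs)]
  rfl

-- If the process is at `x` at a time `t` after the first jump, the chain is at `x` after some `k ≥
-- 1` jumps. The indicators vanish from `l = k` on, and the first `k` holding times add up to at
-- most `t`.
omit [MeasurableSpace X] [Countable X] [MeasurableSingletonClass X] in
theorem tsum_holding_le_returnTime {φ : X → E} (hφ : φ.Injective) (x : X) {ω : ℕ → X × ℝ}
    (hω : ∀ l, 0 ≤ (ω (l + 1)).2) :
    ∑' l, (avoiding x l).indicator (fun _ => 1) (Preorder.frestrictLe l ω) *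
      ENNReal.ofReal (ω (l + 1)).2 ≤ returnTime φ x ω := by
  have hmono : Monotone (jumpTime ω) := monotone_nat_of_le_succ fun k => by
    simpa [jumpTime, Finset.sum_range_succ] using hω k
  refine le_iInf₂ fun t ht => ?_
  obtain ⟨k, hkx, hk1, hk2⟩ := jumpTime_le_of_process hφ ht.2
  have hk : 1 ≤ k := by
    by_contra hc
    have : k = 0 := by omega
    subst this
    exact absurd ht.1 (not_le.2 hk2)
  rw [tsum_eq_sum (s := Finset.range k)]
  · calc _ ≤ ∑ l ∈ Finset.range k, ENNReal.ofReal (ω (l + 1)).2 := by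
          refine Finset.sum_le_sum fun l _ => ?_
          refine mul_le_of_le_one_left' ?_
          exact Set.indicator_le_self' (fun _ _ => zero_le) _
      _ = ENNReal.ofReal (jumpTime ω k) := by
          rw [jumpTime, ENNReal.ofReal_sum_of_nonneg fun l _ => hω l]
      _ ≤ ENNReal.ofReal t := ENNReal.ofReal_le_ofReal hk1
  · intro l hl
    have : Preorder.frestrictLe l ω ∉ avoiding x l := by
      rw [frestrictLe_mem_avoiding]
      intro hc
      exact hc k hk (by simpa using hl) hkx
    simp [this]

/-- The mean return time dominates the sum of the non-return probabilities of the jump chain. -/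
theorem tsum_avoiding_le_lintegral_returnTime (rate : X → Measure X) {φ : X → E}
    (hφ : φ.Injective) (x : X) {c : ℝ≥0∞}
    (hc : ∀ y, c ≤ ∫⁻ p, ENNReal.ofReal p.2 ∂stepLaw rate y) :
    c * ∑' l, law rate x (Preorder.frestrictLe l ⁻¹' avoiding x l) ≤
      ∫⁻ ω, returnTime φ x ω ∂law rate x := by
  have hpos : ∀ᵐ ω ∂law rate x, ∀ l, 0 ≤ (ω (l + 1)).2 :=
    ae_law_succ rate x (R := fun _ p => 0 ≤ p.2)
      (fun y => measurableSet_le measurable_const measurable_snd) (ae_nonneg_stepLaw rate)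
  have hφm : ∀ l, Measurable ((avoiding x l).indicator fun _ => (1 : ℝ≥0∞)) := fun l =>
    measurable_const.indicator (measurableSet_avoiding x l)
  calc c * ∑' l, law rate x (Preorder.frestrictLe l ⁻¹' avoiding x l)
      = ∑' l, c * law rate x (Preorder.frestrictLe l ⁻¹' avoiding x l) := ENNReal.tsum_mul_left.symm
    _ ≤ ∑' l, ∫⁻ ω, (avoiding x l).indicator (fun _ => 1) (Preorder.frestrictLe l ω) *
          ENNReal.ofReal (ω (l + 1)).2 ∂law rate x := by
        refine ENNReal.tsum_le_tsum fun l => ?_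
        -- Avoidance up to step `l` depends on the history only, so the next holding time may be
        -- replaced by its conditional mean, which is at least `c`.
        rw [lintegral_law_succ_mul rate x l (hφm l) (F := fun p => ENNReal.ofReal p.2)
          (by fun_prop)]
        calc c * law rate x (Preorder.frestrictLe l ⁻¹' avoiding x l)
            = ∫⁻ ω, c * (avoiding x l).indicator (fun _ => 1) (Preorder.frestrictLe l ω)
                ∂law rate x := (lintegral_const_mul_avoiding rate x l c).symm
          _ ≤ _ := lintegral_mono fun ω => by
              rw [mul_comm]
              gcongr
              exact hc _
    _ = ∫⁻ ω, ∑' l, (avoiding x l).indicator (fun _ => 1) (Preorder.frestrictLe l ω) *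
          ENNReal.ofReal (ω (l + 1)).2 ∂law rate x := by
        rw [lintegral_tsum]
        intro l
        exact (((hφm l).comp (by fun_prop)).mul (by fun_prop)).aemeasurable
    _ ≤ _ := lintegral_mono_ae (hpos.mono fun ω hω => tsum_holding_le_returnTime hφ x hω)

/-- A nonnegative function vanishing at `x`, with upward jumps of bounded size, which is
subharmonic for the jump chain and not harmonic at `x`, precludes a finite mean return time. -/
theorem not_isPositiveRecurrentAt_of_subharmonic (rate : X → Measure X) {φ : X → E}
    (hφ : φ.Injective) (x : X) {c : ℝ≥0∞} (hc0 : c ≠ 0)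
    (hc : ∀ y, c ≤ ∫⁻ p, ENNReal.ofReal p.2 ∂stepLaw rate y)
    (u : X → ℝ≥0∞) (hux : u x = 0) (hsub : ∀ y, u y ≤ ∫⁻ p, u p.1 ∂stepLaw rate y)
    (hpos : ∫⁻ p, u p.1 ∂stepLaw rate x ≠ 0) {W : ℝ≥0∞} (hW : W ≠ ⊤)
    (hjump : ∀ y, ∀ᵐ p ∂stepLaw rate y, u p.1 ≤ u y + W) :
    ¬ IsPositiveRecurrentAt rate φ x := by
  intro hrec
  have hu : Measurable u := measurable_of_countable u
  let P : ℕ → ℝ≥0∞ := fun l => law rate x (Preorder.frestrictLe l ⁻¹' avoiding x l)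
  have hP : ∑' l, P l ≠ ⊤ := by
    intro htop
    have h1 := tsum_avoiding_le_lintegral_returnTime rate hφ x hc
    change c * ∑' l, P l ≤ _ at h1
    rw [htop, ENNReal.mul_top hc0] at h1
    exact absurd hrec (not_lt.2 h1)
  have hφm : ∀ l, Measurable ((avoiding x l).indicator fun _ => (1 : ℝ≥0∞)) := fun l =>
    measurable_const.indicator (measurableSet_avoiding x l)
  let a : ℕ → ℝ≥0∞ := fun l =>
    ∫⁻ ω, (avoiding x l).indicator (fun _ => 1) (Preorder.frestrictLe l ω) * u (ω l).1 ∂law rate x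
  -- Because `u x = 0`, a return at step `l + 1` contributes nothing, and avoidance need only be
  -- required up to step `l`.
  have hstep : ∀ l, a (l + 1) = ∫⁻ ω, (avoiding x l).indicator (fun _ => 1)
      (Preorder.frestrictLe l ω) * ∫⁻ p, u p.1 ∂stepLaw rate (ω l).1 ∂law rate x := by
    intro l
    rw [← lintegral_law_succ_mul rate x l (hφm l) (F := fun p => u p.1) (by fun_prop)]
    refine lintegral_congr fun ω => ?_
    by_cases hx : (ω (l + 1)).1 = x
    · simp [hx, hux]
    · congr 1
      have : Preorder.frestrictLe (l + 1) ω ∈ avoiding x (l + 1) ↔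
          Preorder.frestrictLe l ω ∈ avoiding x l := by
        simp only [frestrictLe_mem_avoiding]
        constructor
        · exact fun h j h1 h2 => h j h1 (by omega)
        · intro h j h1 h2
          rcases Nat.lt_or_ge l j with h3 | h3
          · obtain rfl : j = l + 1 := by omega
            exact hx
          · exact h j h1 h3
      by_cases hm : Preorder.frestrictLe l ω ∈ avoiding x l
      · simp [hm, this.2 hm]
      · simp [hm, mt this.1 hm]
  have ha1 : a 1 = ∫⁻ p, u p.1 ∂stepLaw rate x := by
    rw [hstep 0, lintegral_congr_ae (g := fun _ => ∫⁻ p, u p.1 ∂stepLaw rate x)]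
    · simp
    · filter_upwards [ae_law_zero rate x] with ω hω
      have : Preorder.frestrictLe 0 ω ∈ avoiding x 0 := by
        rw [frestrictLe_mem_avoiding]
        intros
        omega
      rw [Set.indicator_of_mem this, hω, one_mul]
  have hmono : Monotone a := monotone_nat_of_le_succ fun l => by
    rw [hstep l]
    exact lintegral_mono fun ω => by
      dsimp only
      gcongr
      exact hsub _
  have hbound : ∀ᵐ ω ∂law rate x, ∀ l : ℕ, u (ω l).1 ≤ l * W := by
    filter_upwards [ae_law_zero rate x, ae_law_succ rate x (R := fun y p => u p.1 ≤ u y + W)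
      (fun y => measurableSet_le (by fun_prop) measurable_const) hjump] with ω h0 hs l
    induction l with
    | zero => simp [h0, hux]
    | succ l ih =>
      refine (hs l).trans ?_
      push_cast
      rw [add_mul, one_mul]
      gcongr
  have hupper : ∀ l : ℕ, a l ≤ l * W * P l := by
    intro l
    calc a l ≤ ∫⁻ ω, (l * W) * (avoiding x l).indicator (fun _ => 1) (Preorder.frestrictLe l ω)
          ∂law rate x := lintegral_mono_ae (hbound.mono fun ω hω => by
            rw [mul_comm]
            gcongr
            exact hω l)
      _ = l * W * P l := lintegral_const_mul_avoiding rate x l _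
  have ha1pos : a 1 ≠ 0 := ha1 ▸ hpos
  have hPtop : ∀ l, P l ≠ ⊤ := fun l => measure_ne_top _ _
  have ha1top : a 1 ≠ ⊤ := ne_top_of_le_ne_top
    (ENNReal.mul_ne_top (ENNReal.mul_ne_top (by simp) hW) (hPtop 1)) (hupper 1)
  have hsumm : Summable fun l => (P l).toReal := ENNReal.summable_toReal hP
  have hapos : 0 < (a 1).toReal := ENNReal.toReal_pos ha1pos ha1top
  -- Compares the non-return probabilities with the harmonic series; at `l = 0` the left side is
  -- zero since `1 / 0 = 0`.
  have hle : ∀ l : ℕ, (1 / (l : ℝ)) * (a 1).toReal ≤ W.toReal * (P l).toReal := by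
    intro l
    rcases Nat.eq_zero_or_pos l with rfl | hl
    · simp only [Nat.cast_zero, div_zero, zero_mul]
      positivity
    · have h1 := ENNReal.toReal_mono (ENNReal.mul_ne_top (ENNReal.mul_ne_top (by simp) hW)
        (hPtop l)) ((hmono hl).trans (hupper l))
      simp only [ENNReal.toReal_mul, ENNReal.toReal_natCast] at h1
      have hl' : (0 : ℝ) < l := by exact_mod_cast hl
      rw [one_div, inv_mul_le_iff₀ hl']
      linarith
  have : Summable fun l : ℕ => (1 / (l : ℝ)) * (a 1).toReal :=
    Summable.of_nonneg_of_le (fun l => by positivity) hle (hsumm.mul_left _)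
  exact Real.not_summable_one_div_natCast ((summable_mul_right_iff hapos.ne').1 this)

end CTMC

/-! ### Weights that diagonalize `B₁`, and the drift bound -/

theorem networkGraph_exists_edge {m J : ℕ} {E : Finset (Fin m × Fin J)}
    (h : (networkGraph E).IsTree) (k : Fin J) (i : Fin m) : ∃ j, (i, j) ∈ E := by
  obtain ⟨p⟩ := h.connected.preconnected (.inl i) (.inr k)
  cases p with
  | @cons _ v _ huv _ =>
    rcases v with i' | j
    · exact huv.elim
    · exact ⟨j, huv⟩

/-- Along an edge, one unit of flow on that edge alone has the prescribed marginals, and such an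
array is unique. -/
theorem flowMap_unitPair {m J : ℕ} {E : Finset (Fin m × Fin J)} (h : (networkGraph E).IsTree)
    {a : Fin m} {k : Fin J} (hak : (a, k) ∈ E) :
    (flowMap h (unitPair a k)).1 = Pi.single a (Pi.single k 1) := by
  let ψ : edgeSpace E := ⟨Pi.single a (Pi.single k 1), by
    intro i j hij
    by_cases hi : i = a
    · subst hi
      by_cases hj : j = k
      · subst hj; exact absurd hak hij
      · simp [hj]
    · simp [hi]⟩
  have hψ : marginals E ψ = unitPair a k := by
    apply Subtype.ext
    ext c
    · by_cases hc : c = a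
      · subst hc; simp [marginals, ψ, unitPair]
      · simp [marginals, ψ, unitPair, hc]
    · simp only [marginals, ψ, unitPair, LinearMap.coe_mk, AddHom.coe_mk]
      rw [Finset.sum_eq_single a] <;> simp +contextual
  rw [← hψ]
  exact congrArg Subtype.val
    ((LinearEquiv.ofBijective (marginals E) (marginals_bijective h)).symm_apply_apply ψ)

namespace ServerNetworks

variable {m J : ℕ} (S : ServerNetworks m J)

/-- A walk that enters a leaf pool can only go back to the class it came from. Hence a walk from
class `i` to pool `k` can reach `k` only if `i` is adjacent to it. -/
theorem IsDominantPool.mem_edges {S : ServerNetworks m J} {k : Fin J} (hk : S.IsDominantPool k)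
    (i : Fin m) : (i, k) ∈ S.edges := by
  -- The invariant is carried backwards from the end of the walk; at a pool other than `k` it speaks
  -- of the neighbours of that pool, of which there is just one.
  have key : ∀ u v, (networkGraph S.edges).Walk u v → v = .inr k →
      Sum.elim (fun i => (i, k) ∈ S.edges)
        (fun j => j = k ∨ ∀ i, (i, j) ∈ S.edges → (i, k) ∈ S.edges) u := by
    intro u v p
    induction p with
    | nil => rintro rfl; simp
    | @cons u v w huv _ ih =>
      intro hw
      have hv := ih hw
      rcases u with i | j <;> rcases v with i' | j'
      · exact huv.elim
      · have hij : (i, j') ∈ S.edges := huv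
        rcases hv with rfl | hv
        · exact hij
        · exact hv i hij
      · by_cases hj : j = k
        · exact .inl hj
        · exact .inr fun i hi => (hk j hj).unique hi huv ▸ hv
      · exact huv.elim
  obtain ⟨p⟩ := S.isTree.connected.preconnected (.inl i) (.inr k)
  exact key _ _ p rfl

/-- With a dominant pool or class-dependent rates, `B₁` is diagonal, and its inverse weighs the
classes so that a busy server of a pool drains the same weight whichever class it serves. -/
theorem exists_weights {n : ℕ} (hn : 1 ≤ n) {k : Fin J}
    (hk : S.IsDominantPool k ∨ S.HasClassDependentRates n) :
    ∃ (w : Fin m → ℝ) (c : Fin J → ℝ), (∀ i, 0 < w i) ∧ (∀ j, 0 ≤ c j) ∧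
      (∀ i j, (i, j) ∈ S.edges → w i * S.service n i j = c j) ∧
      driftMatrix S.isTree (S.service n) k = Matrix.diagonal fun i => (w i)⁻¹ := by
  classical
  rcases hk with hk | ⟨μ, hμ⟩
  · have hpos : ∀ i, 0 < S.service n i k := fun i => S.service_pos n hn i k (hk.mem_edges i)
    have hnn : ∀ i j, 0 ≤ S.service n i j := fun i j => by
      by_cases h : (i, j) ∈ S.edges
      · exact (S.service_pos n hn i j h).le
      · exact (S.service_zero n hn i j h).ge
    -- The weights normalize the drain at pool `k` to one. For `j ≠ k` the sum has a single nonzero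
    -- term, at the only class which pool `j` serves.
    refine ⟨fun i => (S.service n i k)⁻¹, fun j => if j = k then 1 else
      ∑ i, (S.service n i k)⁻¹ * S.service n i j, fun i => inv_pos.2 (hpos i), ?_, ?_, ?_⟩
    · intro j
      dsimp only
      split_ifs
      · exact zero_le_one
      · exact Finset.sum_nonneg fun i _ => mul_nonneg (inv_pos.2 (hpos i)).le (hnn i j)
    · intro i j hij
      dsimp only
      split_ifs with hj
      · subst hj
        exact inv_mul_cancel₀ (hpos i).ne'
      · rw [Finset.sum_eq_single i]
        · intro i' _ hi'
          rw [S.service_zero n hn i' j, mul_zero]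
          exact fun h => hi' ((hk j hj).unique h hij)
        · simp
    · ext i a
      simp only [driftMatrix, Matrix.of_apply, flowMap_unitPair S.isTree (hk.mem_edges a), inv_inv]
      by_cases hi : i = a
      · subst hi; simp [Pi.single_apply]
      · simp [hi]
  · have hpos : ∀ i, 0 < μ i := fun i => by
      obtain ⟨j, hj⟩ := networkGraph_exists_edge S.isTree k i
      exact hμ i j hj ▸ S.service_pos n hn i j hj
    refine ⟨fun i => (μ i)⁻¹, fun _ => 1, fun i => inv_pos.2 (hpos i), fun _ => zero_le_one,
      fun i j hij => ?_, ?_⟩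
    · rw [hμ i j hij]
      exact inv_mul_cancel₀ (hpos i).ne'
    · ext i a
      -- The rate factors out of the row, leaving the row sum of the flow, which is the `i`-th entry
      -- of the unit vector at `a`.
      have h1 : ∀ j, S.service n i j * (flowMap S.isTree (unitPair a k)).1 i j =
          μ i * (flowMap S.isTree (unitPair a k)).1 i j := fun j => by
        by_cases h : (i, j) ∈ S.edges
        · rw [hμ i j h]
        · rw [(flowMap S.isTree (unitPair a k)).2 i j h, mul_zero, mul_zero]
      simp only [driftMatrix, Matrix.of_apply, h1, ← Finset.mul_sum, inv_inv,
        (flowMap_marginals S.isTree (unitPair a k)).1 i]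
      by_cases hi : i = a
      · subst hi; simp [unitPair]
      · simp [unitPair, hi]

theorem spareCapacity_eq {n : ℕ} {k : Fin J} {w : Fin m → ℝ} (hw : ∀ i, 0 < w i)
    (hB : driftMatrix S.isTree (S.service n) k = Matrix.diagonal fun i => (w i)⁻¹) :
    S.spareCapacity n k = -∑ i, w i * S.ell n i := by
  have hinv : (Matrix.diagonal fun i => (w i)⁻¹)⁻¹ = Matrix.diagonal w := by
    apply Matrix.inv_eq_left_inv
    rw [Matrix.diagonal_mul_diagonal, ← Matrix.diagonal_one]
    congr 1
    funext i
    exact mul_inv_cancel₀ (hw i).ne'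
  simp only [spareCapacity, hB, hinv, Matrix.mulVec_diagonal]

/-- The total service rate of class `i` in the state `x`. -/
def departure (n : ℕ) (z : (Fin m → ℕ) → Fin m → Fin J → ℕ) (x : Fin m → ℕ) (i : Fin m) : ℝ :=
  ∑ j, S.service n i j * z x i j

theorem service_nonneg {n : ℕ} (hn : 1 ≤ n) (i : Fin m) (j : Fin J) : 0 ≤ S.service n i j := by
  by_cases h : (i, j) ∈ S.edges
  · exact (S.service_pos n hn i j h).le
  · exact (S.service_zero n hn i j h).ge

theorem departure_nonneg {n : ℕ} (hn : 1 ≤ n) (z : (Fin m → ℕ) → Fin m → Fin J → ℕ)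
    (x : Fin m → ℕ) (i : Fin m) : 0 ≤ S.departure n z x i :=
  Finset.sum_nonneg fun j _ => mul_nonneg (S.service_nonneg hn i j) (Nat.cast_nonneg _)

/-- The weighted drift is at least `-√n ϱ_n` in every state, under every policy. -/
theorem drift_ge {n : ℕ} (hn : 1 ≤ n) {k : Fin J} {w : Fin m → ℝ} {c : Fin J → ℝ}
    (hw : ∀ i, 0 < w i) (hc : ∀ j, 0 ≤ c j)
    (hwc : ∀ i j, (i, j) ∈ S.edges → w i * S.service n i j = c j)
    (hB : driftMatrix S.isTree (S.service n) k = Matrix.diagonal fun i => (w i)⁻¹)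
    {z : (Fin m → ℕ) → Fin m → Fin J → ℕ} (hz : S.IsPolicy n z) (x : Fin m → ℕ) :
    √(n : ℝ) * -S.spareCapacity n k ≤ ∑ i, w i * (S.arrival n i - S.departure n z x i) := by
  have hxi : ∀ i j, (i, j) ∉ S.edges → S.xi i j = 0 := ((S.xi_unique S.xi).2 rfl).1.2.1
  have hn' : √(n : ℝ) ≠ 0 := (Real.sqrt_pos.2 (by exact_mod_cast hn)).ne'
  have h1 : √(n : ℝ) * -S.spareCapacity n k =
      ∑ i, w i * S.arrival n i - ∑ i, ∑ j, w i * (S.service n i j * S.xi i j * S.servers n j) := by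
    rw [S.spareCapacity_eq hw hB, neg_neg, Finset.mul_sum, ← Finset.sum_sub_distrib]
    refine Finset.sum_congr rfl fun i _ => ?_
    rw [ell, ← Finset.mul_sum, ← mul_sub]
    field_simp
  -- The nominal allocation `ξ*` keeps every server busy, since its columns sum to one.
  have h2 : ∑ i, ∑ j, w i * (S.service n i j * S.xi i j * S.servers n j) =
      ∑ j, c j * S.servers n j := by
    rw [Finset.sum_comm]
    refine Finset.sum_congr rfl fun j _ => ?_
    have : ∀ i, w i * (S.service n i j * S.xi i j * S.servers n j) =
        S.xi i j * (c j * S.servers n j) := fun i => by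
      by_cases h : (i, j) ∈ S.edges
      · rw [← hwc i j h]; ring
      · rw [hxi i j h]; ring
    simp_rw [this]
    rw [← Finset.sum_mul, S.xi_sum, one_mul]
  -- Pool `j` drains `c j` per busy server and has at most `N_j` of them; idling only lowers the
  -- drain.
  have h3 : ∑ i, w i * S.departure n z x i ≤ ∑ j, c j * S.servers n j := by
    simp only [departure, Finset.mul_sum]
    rw [Finset.sum_comm]
    refine Finset.sum_le_sum fun j _ => ?_
    have : ∀ i, w i * (S.service n i j * z x i j) = c j * z x i j := fun i => by
      by_cases h : (i, j) ∈ S.edges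
      · rw [← hwc i j h]; ring
      · rw [(hz x).1 i j h]; simp
    simp_rw [this]
    rw [← Finset.mul_sum]
    refine mul_le_mul_of_nonneg_left ?_ (hc j)
    exact_mod_cast (hz x).2.2 j
  rw [h1, h2]
  simp only [mul_sub, Finset.sum_sub_distrib]
  linarith

/-! ### The jump rates -/

theorem lintegral_rates (n : ℕ) (z : (Fin m → ℕ) → Fin m → Fin J → ℕ) (x : Fin m → ℕ)
    (u : (Fin m → ℕ) → ℝ≥0∞) :
    ∫⁻ y, u y ∂S.rates n z x = ∑ i, (ENNReal.ofReal (S.arrival n i) * u (x + Pi.single i 1) +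
      ENNReal.ofReal (S.departure n z x i) * u (x - Pi.single i 1)) := by
  simp [rates, departure, lintegral_add_measure, lintegral_finsetSum_measure]

/-- The total jump rate. -/
def totalRate (n : ℕ) (z : (Fin m → ℕ) → Fin m → Fin J → ℕ) (x : Fin m → ℕ) : ℝ :=
  ∑ i, (S.arrival n i + S.departure n z x i)

theorem rates_univ {n : ℕ} (hn : 1 ≤ n) (z : (Fin m → ℕ) → Fin m → Fin J → ℕ) (x : Fin m → ℕ) :
    S.rates n z x Set.univ = ENNReal.ofReal (S.totalRate n z x) := by
  have ha : ∀ i, 0 ≤ S.arrival n i := fun i => (S.arrival_pos n hn i).le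
  have hd := S.departure_nonneg hn z x
  rw [← lintegral_one, S.lintegral_rates n z x (fun _ => 1), totalRate,
    ENNReal.ofReal_sum_of_nonneg fun i _ => add_nonneg (ha i) (hd i)]
  simp only [mul_one]
  exact Finset.sum_congr rfl fun i _ => (ENNReal.ofReal_add (ha i) (hd i)).symm

theorem totalRate_pos {n : ℕ} (hn : 1 ≤ n) (k : Fin J) (z : (Fin m → ℕ) → Fin m → Fin J → ℕ)
    (x : Fin m → ℕ) : 0 < S.totalRate n z x := by
  refine Finset.sum_pos (fun i _ => add_pos_of_pos_of_nonneg (S.arrival_pos n hn i)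
    (S.departure_nonneg hn z x i)) ?_
  -- There is at least one class: otherwise column `k` of `ξ*` would sum to zero.
  by_contra h
  have := S.xi_sum k
  rw [Finset.not_nonempty_iff_eq_empty.1 h] at this
  simp at this

theorem exists_totalRate_le {n : ℕ} (hn : 1 ≤ n) {z : (Fin m → ℕ) → Fin m → Fin J → ℕ}
    (hz : S.IsPolicy n z) : ∃ R, ∀ x, S.totalRate n z x ≤ R := by
  refine ⟨∑ i, (S.arrival n i + ∑ j, S.service n i j * S.servers n j), fun x => ?_⟩
  refine Finset.sum_le_sum fun i _ => add_le_add_right (Finset.sum_le_sum fun j _ => ?_) _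
  refine mul_le_mul_of_nonneg_left ?_ (S.service_nonneg hn i j)
  have h1 : z x i j ≤ ∑ i, z x i j :=
    Finset.single_le_sum (f := fun i => z x i j) (fun _ _ => Nat.zero_le _) (Finset.mem_univ i)
  exact_mod_cast h1.trans ((hz x).2.2 j)

theorem departure_eq_zero {n : ℕ} {z : (Fin m → ℕ) → Fin m → Fin J → ℕ} (hz : S.IsPolicy n z)
    {x : Fin m → ℕ} {i : Fin m} (hx : x i = 0) : S.departure n z x i = 0 := by
  have h := (hz x).2.1 i
  rw [hx, Nat.le_zero, Finset.sum_eq_zero_iff] at h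
  exact Finset.sum_eq_zero fun j _ => by rw [h j (Finset.mem_univ j)]; simp

end ServerNetworks

/-! ### The weighted count as a test function -/

/-- The weighted number of customers. -/
def weightedCount {m : ℕ} (w : Fin m → ℝ) (x : Fin m → ℕ) : ℝ := ∑ i, w i * x i

theorem weightedCount_add_single {m : ℕ} (w : Fin m → ℝ) (x : Fin m → ℕ) (i : Fin m) :
    weightedCount w (x + Pi.single i 1) = weightedCount w x + w i := by
  simp [weightedCount, mul_add, Finset.sum_add_distrib, Pi.single_apply]

theorem weightedCount_sub_single {m : ℕ} (w : Fin m → ℝ) {x : Fin m → ℕ} {i : Fin m}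
    (hx : x i ≠ 0) : weightedCount w (x - Pi.single i 1) = weightedCount w x - w i := by
  have : x - Pi.single i 1 + Pi.single i 1 = x := by
    funext j
    by_cases hj : j = i
    · subst hj
      simp
      omega
    · simp [hj]
  have h := weightedCount_add_single w (x - Pi.single i 1) i
  rw [this] at h
  linarith

namespace ServerNetworks

variable {m J : ℕ} (S : ServerNetworks m J)

theorem lintegral_rates_weightedCount {n : ℕ} {z : (Fin m → ℕ) → Fin m → Fin J → ℕ}
    (hz : S.IsPolicy n z) (w : Fin m → ℝ) (g : ℝ → ℝ≥0∞) (x : Fin m → ℕ) :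
    ∫⁻ y, g (weightedCount w y) ∂S.rates n z x =
      ∑ i, (ENNReal.ofReal (S.arrival n i) * g (weightedCount w x + w i) +
        ENNReal.ofReal (S.departure n z x i) * g (weightedCount w x - w i)) := by
  rw [S.lintegral_rates]
  refine Finset.sum_congr rfl fun i _ => ?_
  rw [weightedCount_add_single]
  -- At `x i = 0` truncated subtraction gives `x` instead of `x - e_i`, but there the departure rate
  -- is zero.
  by_cases hx : x i = 0
  · simp [S.departure_eq_zero hz hx]
  · rw [weightedCount_sub_single w hx]

end ServerNetworks

/-- Uses `exp t ≤ 1 + t + t ^ 2` for `|t| ≤ 1`. The first-order terms gain `θ * δ` and the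
second-order ones lose at most `θ * δ / 2`. As the total rate is at most `R`, the net gain is at
least the fraction `θ * δ / (2 * R)` of it. -/
theorem sum_exp_le {ι : Type*} (s : Finset ι) {a d w : ι → ℝ} {θ W δ R : ℝ}
    (ha : ∀ i ∈ s, 0 ≤ a i) (hd : ∀ i ∈ s, 0 ≤ d i) (hw : ∀ i ∈ s, 0 ≤ w i)
    (hwW : ∀ i ∈ s, w i ≤ W) (hθ : 0 < θ) (hθW : θ * W ≤ 1)
    (hR : 0 < R) (hδ : 0 ≤ δ) (hθδ : θ * W ^ 2 * R ≤ δ / 2) (hQ : ∑ i ∈ s, (a i + d i) ≤ R)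
    (hdrift : δ ≤ ∑ i ∈ s, w i * (a i - d i)) :
    ∑ i ∈ s, (a i * Real.exp (-(θ * w i)) + d i * Real.exp (θ * w i)) ≤
      (1 - θ * δ / (2 * R)) * ∑ i ∈ s, (a i + d i) := by
  have hexp : ∀ i ∈ s, a i * Real.exp (-(θ * w i)) + d i * Real.exp (θ * w i) ≤
      (a i + d i) - θ * (w i * (a i - d i)) + θ ^ 2 * W ^ 2 * (a i + d i) := by
    intro i hi
    have h0 : 0 ≤ θ * w i := mul_nonneg hθ.le (hw i hi)
    have h1 : θ * w i ≤ 1 := (mul_le_mul_of_nonneg_left (hwW i hi) hθ.le).trans hθW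
    have hsq : (θ * w i) ^ 2 ≤ θ ^ 2 * W ^ 2 := by
      rw [← mul_pow]
      exact pow_le_pow_left₀ h0 (mul_le_mul_of_nonneg_left (hwW i hi) hθ.le) 2
    have e1 := (abs_le.1 (Real.abs_exp_sub_one_sub_id_le (x := -(θ * w i))
      (by rw [abs_neg, abs_of_nonneg h0]; exact h1))).2
    have e2 := (abs_le.1 (Real.abs_exp_sub_one_sub_id_le (x := θ * w i)
      (by rw [abs_of_nonneg h0]; exact h1))).2
    have f1 := mul_le_mul_of_nonneg_left (a := a i)
      (show Real.exp (-(θ * w i)) ≤ 1 - θ * w i + θ ^ 2 * W ^ 2 by nlinarith) (ha i hi)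
    have f2 := mul_le_mul_of_nonneg_left (a := d i)
      (show Real.exp (θ * w i) ≤ 1 + θ * w i + θ ^ 2 * W ^ 2 by nlinarith) (hd i hi)
    linarith
  have hsum := Finset.sum_le_sum hexp
  rw [Finset.sum_add_distrib (f := fun i => _ - _), Finset.sum_sub_distrib, ← Finset.mul_sum,
    ← Finset.mul_sum] at hsum
  set Q := ∑ i ∈ s, (a i + d i)
  have hQ0 : 0 ≤ Q := Finset.sum_nonneg fun i hi => add_nonneg (ha i hi) (hd i hi)
  have h1 : θ * δ ≤ θ * ∑ i ∈ s, w i * (a i - d i) := mul_le_mul_of_nonneg_left hdrift hθ.le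
  have h2 : θ ^ 2 * W ^ 2 * Q ≤ θ * (δ / 2) := by
    calc θ ^ 2 * W ^ 2 * Q ≤ θ ^ 2 * W ^ 2 * R := mul_le_mul_of_nonneg_left hQ (by positivity)
      _ = θ * (θ * W ^ 2 * R) := by ring
      _ ≤ _ := mul_le_mul_of_nonneg_left hθδ hθ.le
  have h3 : θ * δ / (2 * R) * Q ≤ θ * δ / 2 := by
    calc θ * δ / (2 * R) * Q ≤ θ * δ / (2 * R) * R := mul_le_mul_of_nonneg_left hQ (by positivity)
      _ = θ * δ / 2 := by field_simp
  linarith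

/-! ### The two recurrence criteria applied to the networks -/

namespace ServerNetworks

variable {m J : ℕ} (S : ServerNetworks m J)

theorem diffusionScale_injective {n : ℕ} (hn : 1 ≤ n) :
    Function.Injective (S.diffusionScale n) := by
  intro x y hxy
  have hn' : √(n : ℝ) ≠ 0 := (Real.sqrt_pos.2 (by exact_mod_cast hn)).ne'
  funext i
  have h := congrFun hxy i
  simp only [diffusionScale] at h
  rw [div_left_inj' hn', sub_left_inj] at h
  exact_mod_cast h

theorem rates_real_univ {n : ℕ} (hn : 1 ≤ n) (k : Fin J) (z : (Fin m → ℕ) → Fin m → Fin J → ℕ)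
    (x : Fin m → ℕ) : (S.rates n z x).real Set.univ = S.totalRate n z x := by
  rw [measureReal_def, S.rates_univ hn, ENNReal.toReal_ofReal (S.totalRate_pos hn k z x).le]

theorem lintegral_stepLaw_weightedCount {n : ℕ} (hn : 1 ≤ n) (k : Fin J)
    {z : (Fin m → ℕ) → Fin m → Fin J → ℕ} (hz : S.IsPolicy n z) (w : Fin m → ℝ) (g : ℝ → ℝ≥0∞)
    (x : Fin m → ℕ) :
    ∫⁻ p, g (weightedCount w p.1) ∂CTMC.stepLaw (S.rates n z) x =
      (ENNReal.ofReal (S.totalRate n z x))⁻¹ *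
      ∑ i, (ENNReal.ofReal (S.arrival n i) * g (weightedCount w x + w i) +
        ENNReal.ofReal (S.departure n z x i) * g (weightedCount w x - w i)) := by
  rw [CTMC.lintegral_fst_stepLaw (S.rates n z)
    (by rw [S.rates_real_univ hn k]; exact S.totalRate_pos hn k z x)
    (fun y => g (weightedCount w y)), S.rates_univ hn, S.lintegral_rates_weightedCount hz]

theorem ae_stepLaw_weightedCount_le {n : ℕ} (hn : 1 ≤ n) (k : Fin J)
    {z : (Fin m → ℕ) → Fin m → Fin J → ℕ} (hz : S.IsPolicy n z) {w : Fin m → ℝ}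
    (hw : ∀ i, 0 < w i) (x : Fin m → ℕ) :
    ∀ᵐ p ∂CTMC.stepLaw (S.rates n z) x,
      weightedCount w p.1 ≤ weightedCount w x + ∑ i, w i := by
  -- The indicator of overshooting the bound; its mean after one step is zero.
  let g : ℝ → ℝ≥0∞ := fun t => if t ≤ weightedCount w x + ∑ i, w i then 0 else 1
  have hwi : ∀ i, w i ≤ ∑ i, w i := fun i =>
    Finset.single_le_sum (f := w) (fun i _ => (hw i).le) (Finset.mem_univ i)
  have h := S.lintegral_stepLaw_weightedCount hn k hz w g x
  have h1 : ∀ i, g (weightedCount w x + w i) = 0 := fun i =>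
    if_pos (by linarith [hwi i])
  have h2 : ∀ i, g (weightedCount w x - w i) = 0 := fun i =>
    if_pos (by linarith [hwi i, hw i])
  simp only [h1, h2, mul_zero, add_zero, Finset.sum_const_zero] at h
  have hm : Measurable fun p : (Fin m → ℕ) × ℝ => g (weightedCount w p.1) :=
    (measurable_of_countable fun y => g (weightedCount w y)).comp measurable_fst
  rw [lintegral_eq_zero_iff hm] at h
  filter_upwards [h] with p hp
  by_contra hc
  simp [g, hc] at hp

/-- The contracted function is `exp (-θ V)`, with `V` the weighted count. -/
theorem isTransient_of_drift_pos {n : ℕ} (hn : 1 ≤ n) (k : Fin J)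
    {z : (Fin m → ℕ) → Fin m → Fin J → ℕ} (hz : S.IsPolicy n z) {w : Fin m → ℝ}
    (hw : ∀ i, 0 < w i) {δ : ℝ} (hδ : 0 < δ)
    (hdrift : ∀ x, δ ≤ ∑ i, w i * (S.arrival n i - S.departure n z x i))
    {E : Type*} {φ : (Fin m → ℕ) → E} (hφ : φ.Injective) :
    CTMC.IsTransient (S.rates n z) φ := by
  obtain ⟨R, hR⟩ := S.exists_totalRate_le hn hz
  have hR0 : 0 < R := (S.totalRate_pos hn k z 0).trans_le (hR 0)
  have hW0 : 0 ≤ ∑ i, w i := Finset.sum_nonneg fun i _ => (hw i).le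
  set W := ∑ i, w i + 1
  have hW : 0 < W := by positivity
  have hwW : ∀ i, w i ≤ W := fun i =>
    (Finset.single_le_sum (f := w) (fun i _ => (hw i).le) (Finset.mem_univ i)).trans
      (le_add_of_nonneg_right zero_le_one)
  obtain ⟨θ, hθ, hθW, hθδ⟩ : ∃ θ : ℝ, 0 < θ ∧ θ * W ≤ 1 ∧ θ * W ^ 2 * R ≤ δ / 2 := by
    refine ⟨min (1 / W) (δ / (2 * W ^ 2 * R)), by positivity, ?_, ?_⟩
    · calc _ ≤ 1 / W * W := by gcongr; exact min_le_left _ _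
        _ = 1 := by field_simp
    · calc _ ≤ δ / (2 * W ^ 2 * R) * W ^ 2 * R := by gcongr; exact min_le_right _ _
        _ = δ / 2 := by field_simp
  set κ := θ * δ / (2 * R)
  have hκ : 0 < κ := by positivity
  refine CTMC.isTransient_of_contraction (S.rates n z) hφ
    (fun x => ENNReal.ofReal (Real.exp (-(θ * weightedCount w x))))
    (fun y => by simp [Real.exp_pos]) (fun y => ENNReal.ofReal_ne_top)
    (r := ENNReal.ofReal (1 - κ)) (by rw [ENNReal.ofReal_lt_one]; linarith) fun x => ?_
  have ha : ∀ i, 0 ≤ S.arrival n i := fun i => (S.arrival_pos n hn i).le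
  have hd := S.departure_nonneg hn z x
  have hQ := S.totalRate_pos hn k z x
  rw [S.lintegral_stepLaw_weightedCount hn k hz w
    (fun t => ENNReal.ofReal (Real.exp (-(θ * t))))]
  have hkey := sum_exp_le Finset.univ (fun i _ => ha i) (fun i _ => hd i)
    (fun i _ => (hw i).le) (fun i _ => hwW i) hθ hθW hR0 hδ.le hθδ (hR x) (hdrift x)
  -- The sum bounded in `hkey` is nonnegative and the total rate is positive. The sign is needed
  -- because `ENNReal.ofReal` truncates at zero.
  have hκ1 : 0 ≤ 1 - κ := by
    by_contra hc
    have h0 : 0 ≤ ∑ i, (S.arrival n i * Real.exp (-(θ * w i)) +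
        S.departure n z x i * Real.exp (θ * w i)) := Finset.sum_nonneg fun i _ =>
      add_nonneg (mul_nonneg (ha i) (Real.exp_pos _).le) (mul_nonneg (hd i) (Real.exp_pos _).le)
    exact absurd (h0.trans hkey) (not_le.2 (mul_neg_of_neg_of_pos (not_le.1 hc) hQ))
  rw [mul_comm, ← div_eq_mul_inv]
  refine ENNReal.div_le_of_le_mul ?_
  have hterm : ∀ i, ENNReal.ofReal (S.arrival n i) *
        ENNReal.ofReal (Real.exp (-(θ * (weightedCount w x + w i)))) +
      ENNReal.ofReal (S.departure n z x i) *
        ENNReal.ofReal (Real.exp (-(θ * (weightedCount w x - w i)))) =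
      ENNReal.ofReal (Real.exp (-(θ * weightedCount w x)) *
        (S.arrival n i * Real.exp (-(θ * w i)) + S.departure n z x i * Real.exp (θ * w i))) := by
    intro i
    rw [← ENNReal.ofReal_mul (ha i), ← ENNReal.ofReal_mul (hd i), ← ENNReal.ofReal_add
      (mul_nonneg (ha i) (Real.exp_pos _).le) (mul_nonneg (hd i) (Real.exp_pos _).le),
      show -(θ * (weightedCount w x + w i)) = -(θ * weightedCount w x) + -(θ * w i) by ring,
      show -(θ * (weightedCount w x - w i)) = -(θ * weightedCount w x) + θ * w i by ring,
      Real.exp_add, Real.exp_add]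
    congr 1
    ring
  simp only [hterm]
  rw [← ENNReal.ofReal_sum_of_nonneg fun i _ => mul_nonneg (Real.exp_pos _).le
    (add_nonneg (mul_nonneg (ha i) (Real.exp_pos _).le) (mul_nonneg (hd i) (Real.exp_pos _).le)),
    ← ENNReal.ofReal_mul hκ1, ← ENNReal.ofReal_mul (by positivity), ← Finset.mul_sum]
  refine ENNReal.ofReal_le_ofReal ?_
  calc _ ≤ _ := mul_le_mul_of_nonneg_left hkey (Real.exp_pos _).le
    _ = _ := by rw [totalRate]; ring

/-- The subharmonic function is the positive part of `V - V x`, with the truncation supplied by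
`ENNReal.ofReal`. -/
theorem not_isPositiveRecurrentAt_of_drift_nonneg {n : ℕ} (hn : 1 ≤ n) (k : Fin J)
    {z : (Fin m → ℕ) → Fin m → Fin J → ℕ} (hz : S.IsPolicy n z) {w : Fin m → ℝ}
    (hw : ∀ i, 0 < w i)
    (hdrift : ∀ x, 0 ≤ ∑ i, w i * (S.arrival n i - S.departure n z x i))
    {E : Type*} {φ : (Fin m → ℕ) → E} (hφ : φ.Injective) (x : Fin m → ℕ) :
    ¬ CTMC.IsPositiveRecurrentAt (S.rates n z) φ x := by
  obtain ⟨R, hR⟩ := S.exists_totalRate_le hn hz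
  have hR0 : 0 < R := (S.totalRate_pos hn k z 0).trans_le (hR 0)
  have ha : ∀ i, 0 ≤ S.arrival n i := fun i => (S.arrival_pos n hn i).le
  refine CTMC.not_isPositiveRecurrentAt_of_subharmonic (S.rates n z) hφ x
    (c := ENNReal.ofReal (Real.exp (-1) / R)) ?_ (fun y => ?_)
    (fun y => ENNReal.ofReal (weightedCount w y - weightedCount w x)) (by simp) (fun y => ?_) ?_
    (W := ENNReal.ofReal (∑ i, w i)) ENNReal.ofReal_ne_top (fun y => ?_)
  · rw [ne_eq, ENNReal.ofReal_eq_zero, not_le]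
    positivity
  · apply CTMC.lintegral_snd_stepLaw_ge
    · rw [S.rates_real_univ hn k]
      exact S.totalRate_pos hn k z y
    · rw [S.rates_real_univ hn k]
      exact hR y
  · have hQ := S.totalRate_pos hn k z y
    have hd := S.departure_nonneg hn z y
    rw [S.lintegral_stepLaw_weightedCount hn k hz w
      (fun t => ENNReal.ofReal (t - weightedCount w x)), mul_comm, ← div_eq_mul_inv]
    rw [ENNReal.le_div_iff_mul_le (.inl (by simpa using hQ)) (.inl ENNReal.ofReal_ne_top)]
    rw [mul_comm, ← ENNReal.ofReal_mul hQ.le]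
    -- Jensen's inequality for the positive part, in the form of subadditivity of `ENNReal.ofReal`;
    -- the first inequality is the nonnegative drift.
    calc _ ≤ ENNReal.ofReal (∑ i, (S.arrival n i * (weightedCount w y + w i - weightedCount w x) +
          S.departure n z y i * (weightedCount w y - w i - weightedCount w x))) := by
          refine ENNReal.ofReal_le_ofReal ?_
          have h : ∑ i, (S.arrival n i * (weightedCount w y + w i - weightedCount w x) +
              S.departure n z y i * (weightedCount w y - w i - weightedCount w x)) =
              S.totalRate n z y * (weightedCount w y - weightedCount w x) +
              ∑ i, w i * (S.arrival n i - S.departure n z y i) := by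
            rw [totalRate, Finset.sum_mul, ← Finset.sum_add_distrib]
            exact Finset.sum_congr rfl fun i _ => by ring
          linarith [hdrift y]
      _ ≤ ∑ i, ENNReal.ofReal (S.arrival n i * (weightedCount w y + w i - weightedCount w x) +
          S.departure n z y i * (weightedCount w y - w i - weightedCount w x)) :=
          Finset.le_sum_of_subadditive _ ENNReal.ofReal_zero.le (fun _ _ => ENNReal.ofReal_add_le) _ _
      _ ≤ _ := Finset.sum_le_sum fun i _ => by
          rw [← ENNReal.ofReal_mul (ha i), ← ENNReal.ofReal_mul (hd i)]
          exact ENNReal.ofReal_add_le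
  · rw [S.lintegral_stepLaw_weightedCount hn k hz w
      (fun t => ENNReal.ofReal (t - weightedCount w x))]
    refine mul_ne_zero (ENNReal.inv_ne_zero.2 ENNReal.ofReal_ne_top) ?_
    -- An arrival of any class lifts the function from zero at `x` to `w i > 0`.
    obtain ⟨i, -⟩ := Finset.nonempty_of_sum_ne_zero ((S.xi_sum k).trans_ne one_ne_zero)
    intro h0
    have h1 := Finset.sum_eq_zero_iff.1 h0 i (Finset.mem_univ i)
    have h2 := (add_eq_zero.1 h1).1
    simp only [add_sub_cancel_left, mul_eq_zero, ENNReal.ofReal_eq_zero] at h2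
    exact h2.elim (not_le.2 (S.arrival_pos n hn i)) (not_le.2 (hw i))
  · filter_upwards [S.ae_stepLaw_weightedCount_le hn k hz hw y] with p hp
    refine le_trans (ENNReal.ofReal_le_ofReal ?_) ENNReal.ofReal_add_le
    linarith

end ServerNetworks
end

theorem mainTheorem2 {m J : ℕ} (S : ServerNetworks m J) (n : ℕ) (hn : 1 ≤ n) (k : Fin J)
    (hk : S.IsDominantPool k ∨ S.HasClassDependentRates n)
    (z : (Fin m → ℕ) → Fin m → Fin J → ℕ) (hz : S.IsPolicy n z) :
    (S.spareCapacity n k < 0 →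
      CTMC.IsTransient (S.rates n z) id ∧
      CTMC.IsTransient (S.rates n z) (S.diffusionScale n)) ∧
    (S.spareCapacity n k = 0 → ∀ x : Fin m → ℕ,
      ¬ CTMC.IsPositiveRecurrentAt (S.rates n z) id x ∧
      ¬ CTMC.IsPositiveRecurrentAt (S.rates n z) (S.diffusionScale n) x) := by
  obtain ⟨w, c, hw, hc, hwc, hB⟩ := S.exists_weights hn hk
  have hdrift := S.drift_ge hn hw hc hwc hB hz
  constructor
  · intro hρ
    have hδ : 0 < √(n : ℝ) * -S.spareCapacity n k :=
      mul_pos (Real.sqrt_pos.2 (by exact_mod_cast hn)) (neg_pos.2 hρ)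
    exact ⟨S.isTransient_of_drift_pos hn k hz hw hδ hdrift Function.injective_id,
      S.isTransient_of_drift_pos hn k hz hw hδ hdrift (S.diffusionScale_injective hn)⟩
  · intro hρ x
    simp only [hρ, neg_zero, mul_zero] at hdrift
    exact ⟨S.not_isPositiveRecurrentAt_of_drift_nonneg hn k hz hw hdrift Function.injective_id x,
      S.not_isPositiveRecurrentAt_of_drift_nonneg hn k hz hw hdrift
        (S.diffusionScale_injective hn) x⟩
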